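/- Let $k \ge 1$ be an integer and $p > 1$ a real number. Let $(M,g)$ be a closed Riemannian manifold with the normalized volume measure $m = \mathrm{vol}_g/\mathrm{vol}_g(M)$, and let $U$ be a bounded open subset of a complete Riemannian manifold $N$ with its volume measure. Let $W^{1,p}$ be the space of all $f \in L^p$ with a weak gradient $\nabla f \in L^p$, normed by $\|f\|_{1,p} = (\|f\|_p^p + \|\nabla f\|_p^p)^{1/p}$. For an open set $A$ let $W^{1,p}_0(A)$ be the $W^{1,p}$-closure of the Lipschitz functions with compact support in $A$, and let $$\lambda^D_{1,p}(A) = \inf\left\{ \frac{\|\nabla f\|_p^p}{\|f\|_p^p} \;\middle|\; f \in W^{1,p}_0(A)\setminus\{0\} \right\}.$$ Define $$\overline\lambda_{k,p}(M) = \inf_{A_0,\dots,A_k} \max_{0\le i\le k} \lambda^D_{1,p}(A_i), \qquad \overline\lambda^D_{k,p}(U) = \inf_{B_1,\dots,B_k} \max_{1\le i\le k} \lambda^D_{1,p}(B_i),$$ where $A_0,\dots,A_k$ run over the families of $k+1$ mutually disjoint non-empty open subsets of $M$, and $B_1,\dots,B_k$ over the families of $k$ mutually disjoint non-empty open subsets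 of $U$ (an infimum over the empty set is $+\infty$). The Drábek–Robinson eigenvalues of the $p$-Laplacian are $$\lambda^+_{k,p}(M) = \inf_{h} \sup_{s \in S^k} \|\nabla h(s)\|_p^p, \qquad \lambda^{D,+}_{k,p}(U) = \inf_{h} \sup_{s \in S^{k-1}} \|\nabla h(s)\|_p^p,$$ where $S^{j}$ is the unit sphere of $\mathbb R^{j+1}$ and $h$ runs over all odd maps, continuous for the norm $\|\cdot\|_{1,p}$, from $S^k$ to $\{u \in W^{1,p}(M) : \|u\|_p = 1\}$ in the first case, and from $S^{k-1}$ to $\{u \in W^{1,p}_0(U) : \|u\|_p = 1\}$ in the second. Then $$\lambda^+_{k,p}(M) \le \overline\lambda_{k,p}(M) \qquad\text{and}\qquad \lambda^{D,+}_{k,p}(U) \le \overline\lambda^D_{k,p}(U).$$ -/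

import Mathlib

open scoped Manifold ContDiff ENNReal Topology
open MeasureTheory Bundle

noncomputable section

namespace PLaplace

section Manifold

variable {n : ℕ} {M : Type*} [MetricSpace M]
  [ChartedSpace (EuclideanSpace ℝ (Fin n)) M] [IsManifold (𝓡 n) ∞ M]
  [RiemannianBundle (fun x : M ↦ TangentSpace (𝓡 n) x)]

/-- The coordinate vector field of the chart `φ` around `x₀` in the constant direction `v`, at the
point `φ⁻¹ y` (for `y` in the target of `φ`): the image of `v` under the differential of `φ⁻¹`. -/
def coordVector (x₀ : M) (v y : EuclideanSpace ℝ (Fin n)) :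
    TangentSpace (𝓡 n) ((chartAt (EuclideanSpace ℝ (Fin n)) x₀).symm y) :=
  mfderiv (𝓡 n) (𝓡 n) (chartAt (EuclideanSpace ℝ (Fin n)) x₀).symm y v

/-- The Gram matrix `(g_{ij})` of the Riemannian metric in the chart around `x₀`, at the
coordinate `y`. -/
def gramMatrix (x₀ : M) (y : EuclideanSpace ℝ (Fin n)) : Matrix (Fin n) (Fin n) ℝ :=
  Matrix.of fun i j ↦
    inner ℝ (coordVector x₀ (EuclideanSpace.single i 1) y)
      (coordVector x₀ (EuclideanSpace.single j 1) y)

variable (n M) in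
/-- The Riemannian volume measure. The measure `√(det g_{ij}) dy` on the target of the chart
around `x₀`, transported to `M`, is the restriction of the volume to the domain of this chart; the
volume is the least measure which is bounded below by all these local measures. -/
def riemannianVolume [MeasurableSpace M] : Measure M :=
  ⨆ x₀ : M,
    (((volume : Measure (EuclideanSpace ℝ (Fin n))).restrict
        (chartAt (EuclideanSpace ℝ (Fin n)) x₀).target).withDensity
      fun y ↦ ENNReal.ofReal (Real.sqrt (gramMatrix x₀ y).det)).map
      (chartAt (EuclideanSpace ℝ (Fin n)) x₀).symm

variable (n M) in
/-- The normalized volume measure `vol / vol M`. -/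
def normalizedVolume [MeasurableSpace M] : Measure M :=
  (riemannianVolume n M Set.univ)⁻¹ • riemannianVolume n M

/-- The vector field `G` is a weak gradient of `f`: in each chart, `f` and the components
`⟨G, ∂_v⟩` of `G` are locally integrable, and `⟨G, ∂_v⟩` is the weak derivative of `f` in the
direction `v`. -/
structure IsWeakGradient (f : M → ℝ) (G : (x : M) → TangentSpace (𝓡 n) x) : Prop where
  locallyIntegrableOn : ∀ x₀ : M,
    LocallyIntegrableOn (fun y ↦ f ((chartAt (EuclideanSpace ℝ (Fin n)) x₀).symm y))
      (chartAt (EuclideanSpace ℝ (Fin n)) x₀).target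
  locallyIntegrableOn_inner : ∀ (x₀ : M) (v : EuclideanSpace ℝ (Fin n)),
    LocallyIntegrableOn
      (fun y ↦ inner ℝ (G ((chartAt (EuclideanSpace ℝ (Fin n)) x₀).symm y)) (coordVector x₀ v y))
      (chartAt (EuclideanSpace ℝ (Fin n)) x₀).target
  integral_eq : ∀ (x₀ : M) (v : EuclideanSpace ℝ (Fin n)) (η : EuclideanSpace ℝ (Fin n) → ℝ),
    ContDiff ℝ ∞ η → HasCompactSupport η →
    tsupport η ⊆ (chartAt (EuclideanSpace ℝ (Fin n)) x₀).target →
    ∫ y, f ((chartAt (EuclideanSpace ℝ (Fin n)) x₀).symm y) * fderiv ℝ η y v =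
      - ∫ y, inner ℝ (G ((chartAt (EuclideanSpace ℝ (Fin n)) x₀).symm y)) (coordVector x₀ v y)
          * η y

variable [MeasurableSpace M] (m : Measure M) (p : ℝ)

/-- `‖f‖_p ^ p`. -/
def normPow (f : M → ℝ) : ℝ≥0∞ := ∫⁻ x, ‖f x‖ₑ ^ p ∂m

variable (n) in
/-- `‖∇f‖_p ^ p`. The weak gradient of `f` is unique up to null sets, so that the infimum is over
at most one value; it is `∞` if `f` has no weak gradient. -/
def energy (f : M → ℝ) : ℝ≥0∞ :=
  ⨅ (G : (x : M) → TangentSpace (𝓡 n) x) (_ : IsWeakGradient f G), ∫⁻ x, ‖G x‖ₑ ^ p ∂m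

variable (n) in
/-- The norm `‖f‖_{1,p} = (‖f‖_p ^ p + ‖∇f‖_p ^ p) ^ (1 / p)`. -/
def sobolevNorm (f : M → ℝ) : ℝ≥0∞ := (normPow m p f + energy n m p f) ^ (1 / p)

variable (n) in
/-- The Sobolev space `W^{1,p}`, as a subset of `L^p`. -/
def sobolevSpace : Set (Lp ℝ (ENNReal.ofReal p) m) := {f | sobolevNorm n m p f < ⊤}

variable (n) in
/-- The space `W_0^{1,p}(Ω)`: the closure in `W^{1,p}` of the Lipschitz functions with compact
support in `Ω`. -/
def sobolevSpaceZero (Ω : Set M) : Set (Lp ℝ (ENNReal.ofReal p) m) :=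
  {f | f ∈ sobolevSpace n m p ∧ ∀ ε : ℝ≥0∞, 0 < ε →
    ∃ φ : M → ℝ, (∃ K, LipschitzWith K φ) ∧ HasCompactSupport φ ∧ tsupport φ ⊆ Ω ∧
      sobolevNorm n m p (fun x ↦ f x - φ x) < ε}

variable (n) in
/-- The first Dirichlet eigenvalue `λ_{1,p}^D(A)` of the `p`-Laplacian: the infimum of
`‖∇f‖_p ^ p / ‖f‖_p ^ p` over `f ∈ W_0^{1,p}(A) \ {0}`. -/
def firstDirichletEigenvalue (A : Set M) : ℝ≥0∞ :=
  ⨅ (f : Lp ℝ (ENNReal.ofReal p) m) (_ : f ∈ sobolevSpaceZero n m p A) (_ : f ≠ 0),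
    energy n m p f / normPow m p f

variable (n) in
/-- `\overline λ_{k,p}(M)`: the infimum of `max_i λ_{1,p}^D(A_i)` over all `k + 1` mutually
disjoint non-empty open subsets `A_0, …, A_k` of `M`. -/
def fakeEigenvalue (k : ℕ) : ℝ≥0∞ :=
  ⨅ (A : Fin (k + 1) → Set M) (_ : ∀ i, IsOpen (A i)) (_ : ∀ i, (A i).Nonempty)
    (_ : Pairwise fun i j ↦ Disjoint (A i) (A j)),
    ⨆ i, firstDirichletEigenvalue n m p (A i)

variable (n) in
/-- `\overline λ_{k,p}^D(Ω)`: the infimum of `max_i λ_{1,p}^D(A_i)` over all `k` mutually disjoint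
non-empty open sets `A_1, …, A_k ⊆ Ω` (with `∂A_i ⊆ closure Ω`). -/
def fakeDirichletEigenvalue (Ω : Set M) (k : ℕ) : ℝ≥0∞ :=
  ⨅ (A : Fin k → Set M) (_ : ∀ i, IsOpen (A i)) (_ : ∀ i, (A i).Nonempty)
    (_ : Pairwise fun i j ↦ Disjoint (A i) (A j))
    (_ : ∀ i, A i ⊆ Ω ∧ frontier (A i) ⊆ closure Ω),
    ⨆ i, firstDirichletEigenvalue n m p (A i)

variable (n) in
/-- A map from the unit sphere of `ℝ^d` to the `L^p`-unit sphere of a subset `W` of `W^{1,p}`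
which is odd and continuous for the norm of `W^{1,p}`. -/
structure IsOddSphereMap (W : Set (Lp ℝ (ENNReal.ofReal p) m)) (d : ℕ)
    (h : Metric.sphere (0 : EuclideanSpace ℝ (Fin d)) 1 → Lp ℝ (ENNReal.ofReal p) m) : Prop where
  mem : ∀ s, h s ∈ W
  normPow_eq_one : ∀ s, normPow m p (h s) = 1
  odd : ∀ s, h (-s) = -h s
  continuous : ∀ s, Filter.Tendsto (fun t ↦ sobolevNorm n m p (fun x ↦ h t x - h s x)) (𝓝 s) (𝓝 0)

variable (n) in
/-- The Drábek–Robinson min-max value of order `d` of the `p`-Laplacian on `W`: the infimum, over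
all images `h(S^{d-1})` of odd continuous maps `h` from `S^{d-1}` to `{u ∈ W | ‖u‖_p = 1}`, of the
supremum of `‖∇u‖_p ^ p` over `u ∈ h(S^{d-1})`. -/
def drabekRobinsonValue (W : Set (Lp ℝ (ENNReal.ofReal p) m)) (d : ℕ) : ℝ≥0∞ :=
  ⨅ (h : Metric.sphere (0 : EuclideanSpace ℝ (Fin d)) 1 → Lp ℝ (ENNReal.ofReal p) m)
    (_ : IsOddSphereMap n m p W d h), ⨆ s, energy n m p (h s)

variable (n) in
/-- The Drábek–Robinson eigenvalue `λ_{k,p}^+(M)`, numbered so that `λ_{0,p}^+(M) = 0` belongs to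
the constants: odd maps from `S^k`. -/
def drabekRobinsonEigenvalue (k : ℕ) : ℝ≥0∞ :=
  drabekRobinsonValue n m p (sobolevSpace n m p) (k + 1)

variable (n) in
/-- The Drábek–Robinson Dirichlet eigenvalue `λ_{k,p}^{D,+}(Ω)`: odd maps from `S^{k-1}` to
`W_0^{1,p}(Ω)`. -/
def drabekRobinsonDirichletEigenvalue (Ω : Set M) (k : ℕ) : ℝ≥0∞ :=
  drabekRobinsonValue n m p (sobolevSpaceZero n m p Ω) k

end Manifold

end PLaplace

end

noncomputable section

namespace PLaplace

/-! ### Charts: the coordinate frame, the Gram determinant and null sets -/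

section Chart

variable {n : ℕ} {M : Type*} [MetricSpace M]
  [ChartedSpace (EuclideanSpace ℝ (Fin n)) M] [IsManifold (𝓡 n) ∞ M]
  [RiemannianBundle (fun x : M ↦ TangentSpace (𝓡 n) x)]

/-! Both inequalities come from one construction. Given disjoint open sets `A i` and a finite number
`l` above all their first eigenvalues, pick `f i ≠ 0` in `W_0^{1,p}(A i)` with Rayleigh quotient
below `l`, and map a point `s` of the sphere to the sum of the `c_i(s) f i`, where `c_i(s) =
sign(s_i) |s_i|^(2/p) / ‖f i‖_p`. As the supports are disjoint, `p`-th powers of norms add: the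
`L^p` norm to the power `p` is the sum of the `s_i ^ 2`, that is `1`, and the energy is at most `l`.
The map is odd and continuous, so it competes in the min-max value. This is `exists_isOddSphereMap`,
and `drabekRobinsonValue_le` lets `l` decrease to the maximum.

The analytic point is that an `f i` in the closure, with its gradient, vanishes almost everywhere
off `A i`, including on the boundary, which may have positive measure. For the function this passes
directly to the limit. For the gradient, an approximant supported in `A i` has zero weak gradient
off its support, so off `A i` the gradient of `f i` equals that of the error, whose energy is
arbitrarily small (`IsSobolevLimit.inner_ae_eq_zero`). Hence the gradient may be replaced by its
restriction to `A i`, and additivity becomes pointwise (`normPow_sum`, `energy_sum_le`). Only the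
supports of the approximants matter here, so `IsSobolevLimit` asks for nothing else and also covers
the errors of approximation.

Weak gradients live in charts while norms use the measure `m`; `DominatesChartVolume` is the link
between the two. -/

theorem continuousOn_coordVector (x₀ : M) (v : EuclideanSpace ℝ (Fin n)) :
    ContinuousOn (fun y ↦ (⟨(chartAt (EuclideanSpace ℝ (Fin n)) x₀).symm y,
      coordVector x₀ v y⟩ : TangentBundle (𝓡 n) M))
      (chartAt (EuclideanSpace ℝ (Fin n)) x₀).target := by
  have hopen := (chartAt (EuclideanSpace ℝ (Fin n)) x₀).open_target
  have h := (contMDiffOn_chart_symm (I := 𝓡 n) (n := ∞) (x := x₀)).continuousOn_tangentMapWithin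
    (by simp) hopen.uniqueMDiffOn
  have h2 : Continuous (fun y : EuclideanSpace ℝ (Fin n) ↦
      (⟨y, v⟩ : TangentBundle (𝓡 n) (EuclideanSpace ℝ (Fin n)))) :=
    (tangentBundleModelSpaceHomeomorph (𝓡 n)).symm.continuous.comp
      (continuous_id.prodMk continuous_const)
  refine (h.comp h2.continuousOn fun y hy ↦ hy).congr fun y hy ↦ ?_
  simp only [Function.comp, tangentMapWithin, coordVector]
  rw [mfderivWithin_of_isOpen hopen hy]

theorem linearIndependent_coordVector (x₀ : M) {y : EuclideanSpace ℝ (Fin n)}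
    (hy : y ∈ (chartAt (EuclideanSpace ℝ (Fin n)) x₀).target) :
    LinearIndependent ℝ fun i : Fin n ↦ coordVector x₀ (EuclideanSpace.single i (1 : ℝ)) y := by
  have hinj := ((mdifferentiable_chart (I := 𝓡 n) x₀).symm).ker_mfderiv_eq_bot (x := y) hy
  have hli : LinearIndependent ℝ fun i : Fin n ↦ EuclideanSpace.single i (1 : ℝ) := by
    have h : (fun i : Fin n ↦ EuclideanSpace.single i (1 : ℝ)) =
        EuclideanSpace.basisFun (Fin n) ℝ := by
      funext i
      simp
    rw [h]
    exact (EuclideanSpace.basisFun (Fin n) ℝ).orthonormal.linearIndependent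
  exact hli.map' _ hinj

section Bundle

variable [IsContMDiffRiemannianBundle (𝓡 n) ∞ (EuclideanSpace ℝ (Fin n))
      (fun x : M ↦ TangentSpace (𝓡 n) x)]

theorem continuousOn_inner_coordVector (x₀ : M) (v w : EuclideanSpace ℝ (Fin n)) :
    ContinuousOn (fun y ↦ (inner ℝ (coordVector x₀ v y) (coordVector x₀ w y) : ℝ))
      (chartAt (EuclideanSpace ℝ (Fin n)) x₀).target := by
  have : IsContinuousRiemannianBundle (EuclideanSpace ℝ (Fin n))
      (fun x : M ↦ TangentSpace (𝓡 n) x) := by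
    obtain ⟨g, hg, h⟩ := IsContMDiffRiemannianBundle.exists_contMDiff (IB := 𝓡 n) (n := ∞)
      (F := EuclideanSpace ℝ (Fin n)) (E := fun x : M ↦ TangentSpace (𝓡 n) x)
    exact ⟨g, hg.continuous, h⟩
  exact (continuousOn_coordVector x₀ v).inner_bundle (continuousOn_coordVector x₀ w)

theorem continuousOn_det_gramMatrix (x₀ : M) :
    ContinuousOn (fun y ↦ (gramMatrix x₀ y).det)
      (chartAt (EuclideanSpace ℝ (Fin n)) x₀).target := by
  simp only [Matrix.det_apply']
  exact continuousOn_finsetSum _ fun σ _ ↦ continuousOn_const.mul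
    (continuousOn_finsetProd _ fun i _ ↦ continuousOn_inner_coordVector _ _ _)

end Bundle

theorem det_gramMatrix_pos (x₀ : M) {y : EuclideanSpace ℝ (Fin n)}
    (hy : y ∈ (chartAt (EuclideanSpace ℝ (Fin n)) x₀).target) :
    0 < (gramMatrix x₀ y).det := by
  let F := TangentSpace (𝓡 n) ((chartAt (EuclideanSpace ℝ (Fin n)) x₀).symm y)
  let w : Fin n → F := fun i ↦ coordVector x₀ (EuclideanSpace.single i (1 : ℝ)) y
  have hw : LinearIndependent ℝ w := linearIndependent_coordVector x₀ hy
  have h := Matrix.posDef_gram_of_linearIndependent (𝕜 := ℝ) (E := F) hw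
  exact h.det_pos

/-- The Riemannian volume of `M` read in the chart around `x₀`. -/
def chartVolume (x₀ : M) : Measure (EuclideanSpace ℝ (Fin n)) :=
  (volume.restrict (chartAt (EuclideanSpace ℝ (Fin n)) x₀).target).withDensity
    fun y ↦ ENNReal.ofReal (Real.sqrt (gramMatrix x₀ y).det)

variable [MeasurableSpace M] [BorelSpace M]

theorem chartVolume_absolutelyContinuous (x₀ : M) :
    chartVolume x₀ ≪ volume.restrict (chartAt (EuclideanSpace ℝ (Fin n)) x₀).target :=
  withDensity_absolutelyContinuous _ _

theorem aemeasurable_chart_symm (x₀ : M) :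
    AEMeasurable (chartAt (EuclideanSpace ℝ (Fin n)) x₀).symm (chartVolume x₀) := by
  have h := (chartAt (EuclideanSpace ℝ (Fin n)) x₀).continuousOn_symm.aemeasurable (μ := volume)
    (chartAt (EuclideanSpace ℝ (Fin n)) x₀).open_target.measurableSet
  exact h.mono_ac (chartVolume_absolutelyContinuous x₀)

theorem map_chartVolume_le (x₀ : M) :
    (chartVolume x₀).map (chartAt (EuclideanSpace ℝ (Fin n)) x₀).symm ≤ riemannianVolume n M :=
  le_iSup (fun x₀ : M ↦
    (chartVolume x₀).map (chartAt (EuclideanSpace ℝ (Fin n)) x₀).symm) x₀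

/-- Integrals over a chart are bounded by integrals over the manifold, for arbitrary functions. -/
theorem lintegral_comp_chart_symm_le (x₀ : M) (F : M → ℝ≥0∞) :
    ∫⁻ y, F ((chartAt (EuclideanSpace ℝ (Fin n)) x₀).symm y) ∂chartVolume x₀ ≤
      ∫⁻ x, F x ∂(chartVolume x₀).map (chartAt (EuclideanSpace ℝ (Fin n)) x₀).symm := by
  set e := chartAt (EuclideanSpace ℝ (Fin n)) x₀ with he
  obtain ⟨g, hg, hgF, hgi⟩ := exists_measurable_le_lintegral_eq (chartVolume x₀)
    (fun y ↦ F (e.symm y))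
  classical
  -- `F` need not be measurable, so the change of variables is applied to a measurable minorant of
  -- its chart expression with the same integral, carried to `M` and extended by zero.
  set B : M → ℝ≥0∞ := e.source.piecewise (g ∘ e) 0 with hB
  have hBm : Measurable B := by
    refine measurable_of_restrict_of_restrict_compl e.open_source.measurableSet ?_ ?_
    · have : e.source.domRestrict B = g ∘ e.source.domRestrict e := by
        ext x
        simp [hB]
      rw [this]
      exact hg.comp (continuousOn_iff_continuous_domRestrict.1 e.continuousOn).measurable
    · have : e.sourceᶜ.domRestrict B = fun _ ↦ 0 := by
        ext ⟨x, hx⟩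
        exact Set.piecewise_eq_of_notMem _ _ _ hx
      rw [this]
      exact measurable_const
  have hBF : ∀ x, B x ≤ F x := by
    intro x
    by_cases hx : x ∈ e.source
    · have := hgF (e x)
      simpa [hB, hx] using this
    · simp [hB, hx]
  rw [hgi]
  refine le_trans (le_of_eq ?_) (lintegral_mono hBF)
  rw [lintegral_map' hBm.aemeasurable (aemeasurable_chart_symm x₀)]
  refine lintegral_congr_ae ((chartVolume_absolutelyContinuous x₀).ae_le ?_)
  filter_upwards [ae_restrict_mem e.open_target.measurableSet] with y hy
  have hs : e.symm y ∈ e.source := e.map_target hy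
  change g y = B (e.symm y)
  simp [hB, hs, e.right_inv hy]

variable [IsContMDiffRiemannianBundle (𝓡 n) ∞ (EuclideanSpace ℝ (Fin n))
      (fun x : M ↦ TangentSpace (𝓡 n) x)]

/-- The density of `chartVolume` is strictly positive on the target, so its null sets there are
Lebesgue null. -/
theorem ae_restrict_target_of_ae_chartVolume (x₀ : M) {P : EuclideanSpace ℝ (Fin n) → Prop}
    (h : ∀ᵐ y ∂chartVolume x₀, P y) :
    ∀ᵐ y ∂volume.restrict (chartAt (EuclideanSpace ℝ (Fin n)) x₀).target, P y := by
  have hopen := (chartAt (EuclideanSpace ℝ (Fin n)) x₀).open_target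
  have hm : AEMeasurable (fun y ↦ ENNReal.ofReal (Real.sqrt (gramMatrix x₀ y).det))
      (volume.restrict (chartAt (EuclideanSpace ℝ (Fin n)) x₀).target) :=
    ((continuousOn_det_gramMatrix x₀).aemeasurable hopen.measurableSet).sqrt.ennreal_ofReal
  rw [chartVolume, ae_withDensity_iff' hm] at h
  filter_upwards [h, ae_restrict_mem hopen.measurableSet] with y hy hy2
  exact hy (by simpa using det_gramMatrix_pos x₀ hy2)

/-- `m` dominates the Riemannian volume, up to a finite constant in each chart. -/
def DominatesChartVolume (m : Measure M) : Prop :=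
  ∀ x₀ : M, ∃ C : ℝ≥0∞, C ≠ ⊤ ∧
    (chartVolume x₀).map (chartAt (EuclideanSpace ℝ (Fin n)) x₀).symm ≤ C • m

end Chart

/-! ### Weak gradients: linearity, locality and invariance under null sets -/

theorem integrable_mul_of_tsupport_subset {E : Type*} [NormedAddCommGroup E] [MeasurableSpace E]
    [BorelSpace E] {μ : Measure E} {U : Set E} {f g : E → ℝ} (hf : LocallyIntegrableOn f U μ)
    (hg : Continuous g) (hgc : HasCompactSupport g) (hgU : tsupport g ⊆ U) :
    Integrable (fun y ↦ f y * g y) μ := by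
  have h1 : IntegrableOn f (tsupport g) μ := hf.integrableOn_compact_subset hgU hgc
  have h2 : IntegrableOn (fun y ↦ f y * g y) (tsupport g) μ :=
    h1.mul_continuousOn hg.continuousOn hgc
  refine (integrableOn_iff_integrable_of_support_subset ?_).1 h2
  intro y hy
  exact subset_tsupport g fun h0 ↦ hy (by simp [h0])

theorem fderiv_apply_eq_zero_of_notMem_tsupport {E : Type*} [NormedAddCommGroup E]
    [NormedSpace ℝ E] {η : E → ℝ} {y : E} (v : E) (hy : y ∉ tsupport η) :
    fderiv ℝ η y v = 0 := by
  rw [image_eq_zero_of_notMem_tsupport fun h ↦ hy (tsupport_fderiv_subset ℝ h),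
    zero_apply]

section Gradient

variable {n : ℕ} {M : Type*} [MetricSpace M]
  [ChartedSpace (EuclideanSpace ℝ (Fin n)) M] [IsManifold (𝓡 n) ∞ M]
  [RiemannianBundle (fun x : M ↦ TangentSpace (𝓡 n) x)]

theorem integrable_mul_fderiv {U : Set (EuclideanSpace ℝ (Fin n))}
    {f η : EuclideanSpace ℝ (Fin n) → ℝ} (hf : LocallyIntegrableOn f U)
    (hη : ContDiff ℝ ∞ η) (hηc : HasCompactSupport η) (hηU : tsupport η ⊆ U)
    (v : EuclideanSpace ℝ (Fin n)) : Integrable fun y ↦ f y * fderiv ℝ η y v :=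
  integrable_mul_of_tsupport_subset hf
    ((hη.continuous_fderiv (by simp)).clm_apply continuous_const)
    (hηc.fderiv_apply ℝ v) ((tsupport_fderiv_apply_subset ℝ v).trans hηU)

theorem IsWeakGradient.zero :
    IsWeakGradient (fun _ : M ↦ (0 : ℝ)) (fun x ↦ (0 : TangentSpace (𝓡 n) x)) where
  locallyIntegrableOn _ := (locallyIntegrable_zero (μ := volume)).locallyIntegrableOn _
  locallyIntegrableOn_inner x₀ v := by
    simp only [inner_zero_left]
    exact (locallyIntegrable_zero (μ := volume)).locallyIntegrableOn _
  integral_eq x₀ v η _ _ _ := by simp only [inner_zero_left]; simp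

variable {f g : M → ℝ} {G H : (x : M) → TangentSpace (𝓡 n) x}

theorem IsWeakGradient.add (hf : IsWeakGradient f G) (hg : IsWeakGradient g H) :
    IsWeakGradient (fun x ↦ f x + g x) (fun x ↦ G x + H x) where
  locallyIntegrableOn x₀ := (hf.1 x₀).add (hg.1 x₀)
  locallyIntegrableOn_inner x₀ v := by
    simp only [inner_add_left]
    exact (hf.2 x₀ v).add (hg.2 x₀ v)
  integral_eq x₀ v η h1 h2 h3 := by
    simp only [inner_add_left, add_mul]
    rw [integral_add (integrable_mul_fderiv (hf.1 x₀) h1 h2 h3 v)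
        (integrable_mul_fderiv (hg.1 x₀) h1 h2 h3 v),
      integral_add (integrable_mul_of_tsupport_subset (hf.2 x₀ v) h1.continuous h2 h3)
        (integrable_mul_of_tsupport_subset (hg.2 x₀ v) h1.continuous h2 h3),
      hf.3 x₀ v η h1 h2 h3, hg.3 x₀ v η h1 h2 h3, neg_add]

theorem IsWeakGradient.const_mul (hf : IsWeakGradient f G) (c : ℝ) :
    IsWeakGradient (fun x ↦ c * f x) (fun x ↦ c • G x) where
  locallyIntegrableOn x₀ := (hf.1 x₀).smul c
  locallyIntegrableOn_inner x₀ v := by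
    simp only [real_inner_smul_left]
    exact (hf.2 x₀ v).smul c
  integral_eq x₀ v η h1 h2 h3 := by
    simp only [real_inner_smul_left, mul_assoc]
    rw [integral_const_mul, integral_const_mul, hf.3 x₀ v η h1 h2 h3, mul_neg]

theorem IsWeakGradient.sub (hf : IsWeakGradient f G) (hg : IsWeakGradient g H) :
    IsWeakGradient (fun x ↦ f x - g x) (fun x ↦ G x - H x) := by
  simpa [sub_eq_add_neg] using hf.add (hg.const_mul (-1))

theorem IsWeakGradient.sum {ι : Type*} {u : ι → M → ℝ}
    {G : ι → (x : M) → TangentSpace (𝓡 n) x} (s : Finset ι) (c : ι → ℝ)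
    (h : ∀ i, IsWeakGradient (u i) (G i)) :
    IsWeakGradient (fun x ↦ ∑ i ∈ s, c i * u i x) (fun x ↦ ∑ i ∈ s, c i • G i x) := by
  classical
  induction s using Finset.induction_on with
  | empty => simpa using IsWeakGradient.zero
  | insert a s ha ih =>
    simp only [Finset.sum_insert ha]
    exact ((h a).const_mul (c a)).add ih

/-- A weak gradient vanishes almost everywhere off the support of the function. -/
theorem IsWeakGradient.inner_ae_eq_zero (hf : IsWeakGradient f G) (x₀ : M)
    (v : EuclideanSpace ℝ (Fin n)) :
    ∀ᵐ y, y ∈ (chartAt (EuclideanSpace ℝ (Fin n)) x₀).target →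
      (chartAt (EuclideanSpace ℝ (Fin n)) x₀).symm y ∉ tsupport f →
      (inner ℝ (G ((chartAt (EuclideanSpace ℝ (Fin n)) x₀).symm y))
        (coordVector x₀ v y) : ℝ) = 0 := by
  set e := chartAt (EuclideanSpace ℝ (Fin n)) x₀ with he
  have hopen : IsOpen (e.target ∩ e.symm ⁻¹' (tsupport f)ᶜ) :=
    e.isOpen_inter_preimage_symm (isClosed_tsupport f).isOpen_compl
  have key := hopen.ae_eq_zero_of_integral_contDiff_smul_eq_zero (μ := volume)
    (f := fun y ↦ (inner ℝ (G (e.symm y)) (coordVector x₀ v y) : ℝ))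
    ((hf.2 x₀ v).mono_set Set.inter_subset_left) ?_
  · filter_upwards [key] with y hy h1 h2
    exact hy ⟨h1, h2⟩
  · intro η h1 h2 h3
    have h := hf.3 x₀ v η h1 h2 (h3.trans Set.inter_subset_left)
    -- For a test function living off the support of `f`, the left side of the integration by parts
    -- vanishes; the fundamental lemma of the calculus of variations then applies.
    have h0 : ∀ y, f (e.symm y) * fderiv ℝ η y v = 0 := by
      intro y
      by_cases hy : y ∈ tsupport η
      · rw [image_eq_zero_of_notMem_tsupport (h3 hy).2, zero_mul]
      · rw [fderiv_apply_eq_zero_of_notMem_tsupport v hy, mul_zero]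
    rw [integral_congr_ae (Filter.Eventually.of_forall h0)] at h
    simp only [smul_eq_mul, mul_comm (η _)]
    simpa using h.symm

/-- Weak gradients may be cut off outside a set off which they vanish almost everywhere. -/
theorem IsWeakGradient.congr_inner (hf : IsWeakGradient f G)
    (h : ∀ (x₀ : M) (v : EuclideanSpace ℝ (Fin n)),
      ∀ᵐ y ∂volume.restrict (chartAt (EuclideanSpace ℝ (Fin n)) x₀).target,
        (inner ℝ (G ((chartAt (EuclideanSpace ℝ (Fin n)) x₀).symm y)) (coordVector x₀ v y) : ℝ) =
        inner ℝ (H ((chartAt (EuclideanSpace ℝ (Fin n)) x₀).symm y)) (coordVector x₀ v y)) :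
    IsWeakGradient f H where
  locallyIntegrableOn := hf.1
  locallyIntegrableOn_inner x₀ v := (hf.2 x₀ v).congr (h x₀ v)
  integral_eq x₀ v η h1 h2 h3 := by
    rw [hf.3 x₀ v η h1 h2 h3]
    congr 1
    have h' := (ae_restrict_iff' (chartAt (EuclideanSpace ℝ (Fin n)) x₀).open_target.measurableSet).1
      (h x₀ v)
    refine integral_congr_ae ?_
    filter_upwards [h'] with y hy
    by_cases hyt : y ∈ tsupport η
    · rw [hy (h3 hyt)]
    · rw [image_eq_zero_of_notMem_tsupport hyt, mul_zero, mul_zero]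

variable [MeasurableSpace M] [BorelSpace M]
  [IsContMDiffRiemannianBundle (𝓡 n) ∞ (EuclideanSpace ℝ (Fin n))
      (fun x : M ↦ TangentSpace (𝓡 n) x)] {m : Measure M} {p : ℝ}

theorem DominatesChartVolume.ae_comp_chart_symm (hm : DominatesChartVolume (n := n) m) (x₀ : M)
    {P : M → Prop} (h : ∀ᵐ x ∂m, P x) :
    ∀ᵐ y ∂volume.restrict (chartAt (EuclideanSpace ℝ (Fin n)) x₀).target,
      P ((chartAt (EuclideanSpace ℝ (Fin n)) x₀).symm y) := by
  obtain ⟨C, -, hC⟩ := hm x₀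
  refine ae_restrict_target_of_ae_chartVolume x₀ (ae_of_ae_map (aemeasurable_chart_symm x₀) ?_)
  exact (Measure.absolutelyContinuous_of_le_smul hC).ae_le h

theorem IsWeakGradient.congr_ae (hm : DominatesChartVolume (n := n) m) (hf : IsWeakGradient f G)
    (hfg : f =ᵐ[m] g) : IsWeakGradient g G where
  locallyIntegrableOn x₀ := (hf.1 x₀).congr (hm.ae_comp_chart_symm x₀ hfg)
  locallyIntegrableOn_inner := hf.2
  integral_eq x₀ v η h1 h2 h3 := by
    rw [← hf.3 x₀ v η h1 h2 h3]
    have h' := (ae_restrict_iff' (chartAt (EuclideanSpace ℝ (Fin n)) x₀).open_target.measurableSet).1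
      (hm.ae_comp_chart_symm x₀ hfg)
    refine integral_congr_ae ?_
    filter_upwards [h'] with y hy
    by_cases hyt : y ∈ tsupport η
    · rw [hy (h3 hyt)]
    · rw [fderiv_apply_eq_zero_of_notMem_tsupport v hyt, mul_zero, mul_zero]

theorem energy_congr_ae (hm : DominatesChartVolume (n := n) m) (hfg : f =ᵐ[m] g) :
    energy n m p f = energy n m p g := by
  have h : ∀ G, IsWeakGradient f G ↔ IsWeakGradient (n := n) g G := fun G ↦
    ⟨fun h ↦ h.congr_ae hm hfg, fun h ↦ h.congr_ae hm hfg.symm⟩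
  simp only [energy, h]

theorem normPow_congr_ae (hfg : f =ᵐ[m] g) : normPow m p f = normPow m p g :=
  lintegral_congr_ae (hfg.mono fun x hx ↦ by simp only [hx])

/-! ### Limits of functions supported in `A` vanish off `A`, with their gradients -/

/-- `u` is a limit in `W^{1,p}` of functions whose supports lie in `A`. -/
def IsSobolevLimit (n : ℕ) {M : Type*} [MetricSpace M]
    [ChartedSpace (EuclideanSpace ℝ (Fin n)) M] [IsManifold (𝓡 n) ∞ M]
    [RiemannianBundle (fun x : M ↦ TangentSpace (𝓡 n) x)] [MeasurableSpace M]
    (m : Measure M) (p : ℝ) (A : Set M) (u : M → ℝ) : Prop :=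
  ∀ ε : ℝ≥0∞, 0 < ε → ∃ φ : M → ℝ, tsupport φ ⊆ A ∧
    normPow m p (fun x ↦ u x - φ x) < ε ∧ energy n m p (fun x ↦ u x - φ x) < ε

theorem IsSobolevLimit.ae_eq_zero {A : Set M} {u : M → ℝ} (hp : 0 < p)
    (hA : MeasurableSet A) (hu : AEStronglyMeasurable u m) (h : IsSobolevLimit n m p A u) :
    ∀ᵐ x ∂m, x ∉ A → u x = 0 := by
  have h0 : ∫⁻ x in Aᶜ, ‖u x‖ₑ ^ p ∂m = 0 := by
    refine nonpos_iff_eq_zero.1 (le_of_forall_gt fun ε hε ↦ ?_)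
    obtain ⟨φ, hφ, h1, -⟩ := h ε hε
    refine lt_of_le_of_lt ?_ h1
    refine le_trans (le_of_eq ?_) (setLIntegral_le_lintegral Aᶜ _)
    refine setLIntegral_congr_fun hA.compl fun x hx ↦ ?_
    simp only [image_eq_zero_of_notMem_tsupport fun h' ↦ hx (hφ h'), sub_zero]
  rw [lintegral_eq_zero_iff' (hu.restrict.enorm.pow_const p)] at h0
  filter_upwards [(ae_restrict_iff' hA.compl).1 h0] with x hx hxA
  simpa [hp, hp.le, not_lt.2 hp.le] using hx hxA

theorem IsSobolevLimit.inner_ae_eq_zero (hm : DominatesChartVolume (n := n) m) {A : Set M}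
    {u : M → ℝ} (hp : 0 < p)
    (hA : MeasurableSet A) (h : IsSobolevLimit n m p A u) (hG : IsWeakGradient u G) (x₀ : M)
    (v : EuclideanSpace ℝ (Fin n)) :
    ∀ᵐ y ∂volume.restrict (chartAt (EuclideanSpace ℝ (Fin n)) x₀).target,
      (chartAt (EuclideanSpace ℝ (Fin n)) x₀).symm y ∉ A →
      (inner ℝ (G ((chartAt (EuclideanSpace ℝ (Fin n)) x₀).symm y))
        (coordVector x₀ v y) : ℝ) = 0 := by
  set e := chartAt (EuclideanSpace ℝ (Fin n)) x₀ with he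
  have htm : MeasurableSet e.target := e.open_target.measurableSet
  obtain ⟨C, hC, hCm⟩ := hm x₀
  have hcv : AEMeasurable (fun y ↦ ‖coordVector x₀ v y‖ₑ) (volume.restrict e.target) := by
    have h1 := ((continuousOn_inner_coordVector x₀ v v).aemeasurable (μ := volume) htm).sqrt
    refine h1.ennreal_ofReal.congr (Filter.Eventually.of_forall fun y ↦ ?_)
    simp only [← ofReal_norm, norm_eq_sqrt_real_inner]
  have hin : AEMeasurable (fun y ↦ ‖(inner ℝ (G (e.symm y)) (coordVector x₀ v y) : ℝ)‖ₑ)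
      (volume.restrict e.target) := (hG.2 x₀ v).aestronglyMeasurable.enorm
  have hS : AEMeasurable e.symm (volume.restrict e.target) := e.continuousOn_symm.aemeasurable htm
  -- `G` is not known to be measurable, but its components are. Dividing by the length of the
  -- coordinate vector makes Cauchy–Schwarz bound the component by `‖H‖`, with no constant.
  set b : EuclideanSpace ℝ (Fin n) → ℝ≥0∞ := fun y ↦ Aᶜ.indicator (fun _ ↦ (1 : ℝ≥0∞)) (e.symm y) *
    (‖(inner ℝ (G (e.symm y)) (coordVector x₀ v y) : ℝ)‖ₑ / ‖coordVector x₀ v y‖ₑ) ^ p with hb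
  have hbm : AEMeasurable b (volume.restrict e.target) :=
    ((measurable_const.indicator hA.compl).comp_aemeasurable hS).mul ((hin.div hcv).pow_const p)
  have h0 : ∫⁻ y, b y ∂chartVolume x₀ = 0 := by
    refine nonpos_iff_eq_zero.1 (le_of_forall_gt_imp_ge_of_dense fun ε hε ↦ ?_)
    obtain ⟨δ, hδ, hδε⟩ : ∃ δ : ℝ≥0∞, 0 < δ ∧ C * δ ≤ ε := by
      refine ⟨ε / C, ENNReal.div_pos hε.ne' hC, ENNReal.mul_div_le⟩
    obtain ⟨φ, hφ, -, h1⟩ := h δ hδ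
    rw [energy] at h1
    simp only [iInf_lt_iff] at h1
    obtain ⟨H, hH, hHδ⟩ := h1
    -- `H` is a weak gradient of the error `u - φ`. Off `A` the components of `G - H` vanish almost
    -- everywhere, so those of `G` are those of the small field `H`.
    have hφg : IsWeakGradient φ (fun x ↦ G x - H x) := by
      simpa using hG.sub hH
    have hle : ∀ᵐ y ∂chartVolume x₀, b y ≤ ‖H (e.symm y)‖ₑ ^ p := by
      refine (chartVolume_absolutelyContinuous x₀).ae_le ?_
      filter_upwards [ae_restrict_of_ae (hφg.inner_ae_eq_zero x₀ v), ae_restrict_mem htm]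
        with y hy hyt
      by_cases hyA : e.symm y ∈ A
      · simp [hb, hyA]
      · have h2 := hy hyt fun h' ↦ hyA (hφ h')
        rw [inner_sub_left, sub_eq_zero] at h2
        simp only [hb, Set.indicator_of_mem (show e.symm y ∈ Aᶜ from hyA), one_mul]
        refine ENNReal.rpow_le_rpow (ENNReal.div_le_of_le_mul ?_) hp.le
        rw [h2, ← ofReal_norm, ← ofReal_norm, ← ofReal_norm,
          ← ENNReal.ofReal_mul (norm_nonneg _)]
        exact ENNReal.ofReal_le_ofReal (norm_inner_le_norm _ _)
    calc ∫⁻ y, b y ∂chartVolume x₀ ≤ ∫⁻ y, ‖H (e.symm y)‖ₑ ^ p ∂chartVolume x₀ :=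
          lintegral_mono_ae hle
      _ ≤ ∫⁻ x, ‖H x‖ₑ ^ p ∂(C • m) :=
          (lintegral_comp_chart_symm_le x₀ fun x ↦ ‖H x‖ₑ ^ p).trans (lintegral_mono' hCm le_rfl)
      _ = C * ∫⁻ x, ‖H x‖ₑ ^ p ∂m := lintegral_smul_measure _ _
      _ ≤ C * δ := by gcongr
      _ ≤ ε := hδε
  rw [lintegral_eq_zero_iff' (hbm.mono_ac (chartVolume_absolutelyContinuous x₀))] at h0
  filter_upwards [ae_restrict_target_of_ae_chartVolume x₀ h0] with y hy hyA
  simp only [hb, Set.indicator_of_mem (show e.symm y ∈ Aᶜ from hyA), one_mul, Pi.zero_apply,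
    ENNReal.rpow_eq_zero_iff_of_pos hp, ENNReal.div_eq_zero_iff, enorm_ne_top, or_false,
    enorm_eq_zero] at hy
  exact hy

open scoped Classical in
theorem IsSobolevLimit.isWeakGradient_ite (hm : DominatesChartVolume (n := n) m) {A : Set M}
    {u : M → ℝ} (hp : 0 < p) (hA : MeasurableSet A) (h : IsSobolevLimit n m p A u)
    (hG : IsWeakGradient u G) : IsWeakGradient u (fun x ↦ if x ∈ A then G x else 0) := by
  refine hG.congr_inner fun x₀ v ↦ ?_
  filter_upwards [h.inner_ae_eq_zero hm hp hA hG x₀ v] with y hy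
  split_ifs with hyA
  · rfl
  · rw [hy hyA, inner_zero_left]

end Gradient

/-! ### Norm and energy of combinations with disjoint supports -/

theorem enorm_sum_rpow_of_pairwise {ι F : Type*} [Fintype ι] [NormedAddCommGroup F] {p : ℝ}
    (hp : 0 < p) (w : ι → F) (hw : Pairwise fun i j ↦ w i = 0 ∨ w j = 0) :
    ‖∑ i, w i‖ₑ ^ p = ∑ i, ‖w i‖ₑ ^ p := by
  by_cases h : ∃ i, w i ≠ 0
  · obtain ⟨i, hi⟩ := h
    have h0 : ∀ j, j ≠ i → w j = 0 := fun j hj ↦ (hw hj).resolve_right hi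
    rw [Finset.sum_eq_single i (fun j _ hj ↦ h0 j hj) (by simp),
      Finset.sum_eq_single i (fun j _ hj ↦ by simp [h0 j hj, hp]) (by simp)]
  · push Not at h
    simp [h, hp]

theorem enorm_smul_rpow {F : Type*} [NormedAddCommGroup F] [NormedSpace ℝ F] {p : ℝ}
    (hp : 0 < p) (c : ℝ) (w : F) : ‖c • w‖ₑ ^ p = ‖c‖ₑ ^ p * ‖w‖ₑ ^ p := by
  rw [enorm_smul, ENNReal.mul_rpow_of_nonneg _ _ hp.le]

section Combination

variable {n : ℕ} {M : Type*} [MetricSpace M]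
  [ChartedSpace (EuclideanSpace ℝ (Fin n)) M] [IsManifold (𝓡 n) ∞ M]
  [RiemannianBundle (fun x : M ↦ TangentSpace (𝓡 n) x)] [MeasurableSpace M] [BorelSpace M]
  [IsContMDiffRiemannianBundle (𝓡 n) ∞ (EuclideanSpace ℝ (Fin n))
      (fun x : M ↦ TangentSpace (𝓡 n) x)]
  {m : Measure M} {p : ℝ} {ι : Type*} [Fintype ι] {A : ι → Set M} {u : ι → M → ℝ}

theorem normPow_sum (hp : 0 < p) (hA : ∀ i, MeasurableSet (A i))
    (hd : Pairwise fun i j ↦ Disjoint (A i) (A j)) (hu : ∀ i, AEStronglyMeasurable (u i) m)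
    (h : ∀ i, IsSobolevLimit n m p (A i) (u i)) (c : ι → ℝ) :
    normPow m p (fun x ↦ ∑ i, c i * u i x) = ∑ i, ‖c i‖ₑ ^ p * normPow m p (u i) := by
  have h0 : ∀ᵐ x ∂m, ∀ i, x ∉ A i → u i x = 0 :=
    ae_all_iff.2 fun i ↦ (h i).ae_eq_zero hp (hA i) (hu i)
  calc normPow m p (fun x ↦ ∑ i, c i * u i x)
      = ∫⁻ x, ∑ i, ‖c i‖ₑ ^ p * ‖u i x‖ₑ ^ p ∂m := by
        refine lintegral_congr_ae ?_
        filter_upwards [h0] with x hx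
        rw [enorm_sum_rpow_of_pairwise hp]
        · exact Finset.sum_congr rfl fun i _ ↦ enorm_smul_rpow hp _ _
        · intro i j hij
          by_cases hi : x ∈ A i
          · right
            rw [hx j (Set.disjoint_left.1 (hd hij) hi), mul_zero]
          · left
            rw [hx i hi, mul_zero]
    _ = ∑ i, ∫⁻ x, ‖c i‖ₑ ^ p * ‖u i x‖ₑ ^ p ∂m :=
        lintegral_finsetSum' _ fun i _ ↦ ((hu i).enorm.pow_const p).const_mul _
    _ = ∑ i, ‖c i‖ₑ ^ p * normPow m p (u i) := by
        refine Finset.sum_congr rfl fun i _ ↦ lintegral_const_mul' _ _ ?_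
        exact ENNReal.rpow_ne_top_of_nonneg hp.le enorm_ne_top

/-- The combination of the truncated gradients is one admissible gradient, and at each point at most
one of its terms is nonzero. Choosing gradients with integral below `l i` avoids any appeal to
uniqueness or to attainment of the infimum. -/
theorem energy_sum_le (hm : DominatesChartVolume (n := n) m) (hp : 0 < p)
    (hA : ∀ i, MeasurableSet (A i))
    (hd : Pairwise fun i j ↦ Disjoint (A i) (A j))
    (h : ∀ i, IsSobolevLimit n m p (A i) (u i)) {l : ι → ℝ≥0∞}
    (hl : ∀ i, energy n m p (u i) < l i) (c : ι → ℝ) :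
    energy n m p (fun x ↦ ∑ i, c i * u i x) ≤ ∑ i, ‖c i‖ₑ ^ p * l i := by
  classical
  have hG : ∀ i, ∃ G : (x : M) → TangentSpace (𝓡 n) x, IsWeakGradient (u i) G ∧
      ∫⁻ x, ‖G x‖ₑ ^ p ∂m < l i := fun i ↦ by
    have := hl i
    simp only [energy, iInf_lt_iff, exists_prop] at this
    exact this
  choose G hG hGl using hG
  have hW := IsWeakGradient.sum Finset.univ c
    fun i ↦ (h i).isWeakGradient_ite hm hp (hA i) (hG i)
  set Φ : (x : M) → TangentSpace (𝓡 n) x :=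
    fun x ↦ ∑ i, c i • (if x ∈ A i then G i x else 0) with hΦ
  have hon : ∀ i, ∀ x ∈ A i, ‖Φ x‖ₑ ^ p = ‖c i‖ₑ ^ p * ‖G i x‖ₑ ^ p := by
    intro i x hx
    have : Φ x = c i • G i x := by
      simp only [hΦ]
      rw [Finset.sum_eq_single i _ (by simp), if_pos hx]
      intro j _ hj
      rw [if_neg (Set.disjoint_right.1 (hd hj) hx), smul_zero]
    rw [this, enorm_smul_rpow hp]
  have hoff : ∀ x, x ∉ ⋃ i ∈ (Finset.univ : Finset ι), A i → ‖Φ x‖ₑ ^ p = 0 := by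
    intro x hx
    have hx' : ∀ i, x ∉ A i := by simpa using hx
    have : Φ x = 0 := Finset.sum_eq_zero fun i _ ↦ by rw [if_neg (hx' i), smul_zero]
    simp [this, hp]
  refine (iInf₂_le Φ hW).trans ?_
  calc ∫⁻ x, ‖Φ x‖ₑ ^ p ∂m
      = ∫⁻ x in ⋃ i ∈ (Finset.univ : Finset ι), A i, ‖Φ x‖ₑ ^ p ∂m := by
        rw [← lintegral_indicator (Finset.measurableSet_biUnion _ fun i _ ↦ hA i)]
        refine lintegral_congr fun x ↦ ?_
        by_cases hx : x ∈ ⋃ i ∈ (Finset.univ : Finset ι), A i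
        · rw [Set.indicator_of_mem hx]
        · rw [Set.indicator_of_notMem hx, hoff x hx]
    -- The integrand may be non-measurable; splitting over finitely many disjoint measurable sets is
    -- still exact.
    _ = ∑ i, ∫⁻ x in A i, ‖Φ x‖ₑ ^ p ∂m :=
        lintegral_biUnion_finset (fun i _ j _ hij ↦ hd hij) (fun i _ ↦ hA i) _
    _ ≤ ∑ i, ‖c i‖ₑ ^ p * l i := by
        refine Finset.sum_le_sum fun i _ ↦ ?_
        rw [setLIntegral_congr_fun (hA i) (hon i),
          lintegral_const_mul' _ _ (ENNReal.rpow_ne_top_of_nonneg hp.le enorm_ne_top)]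
        gcongr
        exact (setLIntegral_le_lintegral _ _).trans (hGl i).le

end Combination

/-! ### Coefficients on the sphere -/

/-- The odd function `x ↦ sign x * |x| ^ q`. -/
def signedPow (q x : ℝ) : ℝ := max x 0 ^ q - max (-x) 0 ^ q

theorem signedPow_neg (q x : ℝ) : signedPow q (-x) = -signedPow q x := by
  simp [signedPow]

theorem continuous_signedPow {q : ℝ} (hq : 0 ≤ q) : Continuous (signedPow q) :=
  ((continuous_id.max continuous_const).rpow_const fun _ ↦ Or.inr hq).sub
    ((continuous_neg.max continuous_const).rpow_const fun _ ↦ Or.inr hq)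

theorem abs_signedPow {q : ℝ} (hq : 0 < q) (x : ℝ) : |signedPow q x| = |x| ^ q := by
  rcases le_total 0 x with hx | hx
  · rw [signedPow, max_eq_left hx, max_eq_right (neg_nonpos.2 hx), Real.zero_rpow hq.ne', sub_zero,
      abs_of_nonneg (Real.rpow_nonneg hx q), abs_of_nonneg hx]
  · rw [signedPow, max_eq_right hx, max_eq_left (neg_nonneg.2 hx), Real.zero_rpow hq.ne', zero_sub,
      abs_neg, abs_of_nonneg (Real.rpow_nonneg (neg_nonneg.2 hx) q), abs_of_nonpos hx]

/-- The exponent `2 / p` turns `p`-th powers into squares, which sum to `1` on the Euclidean sphere;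
the factor `N ^ (-(1 / p))` normalizes a function with `‖f‖_p ^ p = N`. -/
theorem enorm_signedPow_mul_rpow {p N : ℝ} (hp : 0 < p) (hN : 0 < N) (x : ℝ) :
    ‖signedPow (2 / p) x * N ^ (-(1 / p))‖ₑ ^ p * ENNReal.ofReal N = ENNReal.ofReal (x ^ 2) := by
  rw [Real.enorm_eq_ofReal_abs, ENNReal.ofReal_rpow_of_nonneg (abs_nonneg _) hp.le,
    ← ENNReal.ofReal_mul (by positivity), abs_mul, abs_signedPow (by positivity),
    abs_of_nonneg (Real.rpow_nonneg hN.le _), Real.mul_rpow (by positivity) (by positivity),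
    ← Real.rpow_mul (abs_nonneg _), ← Real.rpow_mul hN.le, div_mul_cancel₀ _ hp.ne', neg_mul,
    div_mul_cancel₀ _ hp.ne', Real.rpow_neg_one, mul_assoc, inv_mul_cancel₀ hN.ne', mul_one]
  norm_cast
  rw [sq_abs]

/-! ### Odd spheres in the Sobolev space -/

section Sphere

variable {n : ℕ} {M : Type*} [MetricSpace M]
  [ChartedSpace (EuclideanSpace ℝ (Fin n)) M] [IsManifold (𝓡 n) ∞ M]
  [RiemannianBundle (fun x : M ↦ TangentSpace (𝓡 n) x)] [MeasurableSpace M] [BorelSpace M]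
  [IsContMDiffRiemannianBundle (𝓡 n) ∞ (EuclideanSpace ℝ (Fin n))
      (fun x : M ↦ TangentSpace (𝓡 n) x)]
  {m : Measure M} {p : ℝ}

theorem normPow_lt_top (hp : 0 < p) (f : Lp ℝ (ENNReal.ofReal p) m) : normPow m p f < ⊤ := by
  have h := lintegral_rpow_enorm_lt_top_of_eLpNorm_lt_top (by simpa using hp) ENNReal.ofReal_ne_top
    (Lp.eLpNorm_lt_top f)
  rwa [ENNReal.toReal_ofReal hp.le] at h

theorem normPow_ne_zero (hp : 0 < p) {f : Lp ℝ (ENNReal.ofReal p) m} (hf : f ≠ 0) :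
    normPow m p f ≠ 0 := by
  intro h
  rw [normPow, lintegral_eq_zero_iff' ((Lp.aestronglyMeasurable f).enorm.pow_const p)] at h
  refine hf (Lp.ext ?_)
  filter_upwards [h, Lp.coeFn_zero ℝ (ENNReal.ofReal p) m] with x hx h0
  rw [h0]
  simpa [hp, hp.le, not_lt.2 hp.le] using hx

theorem coeFn_sum_smul {ι : Type*} (s : Finset ι) (c : ι → ℝ)
    (f : ι → Lp ℝ (ENNReal.ofReal p) m) :
    (∑ i ∈ s, c i • f i : Lp ℝ (ENNReal.ofReal p) m) =ᵐ[m] fun x ↦ ∑ i ∈ s, c i * f i x := by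
  classical
  induction s using Finset.induction_on with
  | empty =>
    simp only [Finset.sum_empty]
    exact Lp.coeFn_zero ℝ (ENNReal.ofReal p) m
  | insert a s ha ih =>
    rw [Finset.sum_insert ha]
    filter_upwards [Lp.coeFn_add (c a • f a) (∑ i ∈ s, c i • f i), Lp.coeFn_smul (c a) (f a), ih]
      with x h1 h2 h3
    rw [h1, Pi.add_apply, h2, h3, Finset.sum_insert ha]
    rfl

theorem lt_of_sobolevNorm_lt (hp : 0 < p) {f : M → ℝ} {δ : ℝ≥0∞}
    (h : sobolevNorm n m p f < δ ^ (1 / p)) : normPow m p f < δ ∧ energy n m p f < δ := by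
  have h' := (ENNReal.rpow_lt_rpow_iff (one_div_pos.2 hp)).1 h
  exact ⟨lt_of_le_of_lt le_self_add h', lt_of_le_of_lt le_add_self h'⟩

theorem exists_approx_of_mem_sobolevSpaceZero (hp : 0 < p) {A : Set M}
    {f : Lp ℝ (ENNReal.ofReal p) m}
    (hf : f ∈ sobolevSpaceZero n m p A) {δ : ℝ≥0∞} (hδ : 0 < δ) :
    ∃ φ : M → ℝ, (∃ K, LipschitzWith K φ) ∧ HasCompactSupport φ ∧ tsupport φ ⊆ A ∧
      normPow m p (fun x ↦ f x - φ x) < δ ∧ energy n m p (fun x ↦ f x - φ x) < δ := by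
  -- `δ` may be infinite; the minimum with `1` keeps the base of the power finite.
  obtain ⟨φ, h1, h2, h3, h4⟩ := hf.2 (min δ 1 ^ (1 / p))
    (ENNReal.rpow_pos (lt_min hδ one_pos) (by simp))
  have h5 := lt_of_sobolevNorm_lt hp h4
  exact ⟨φ, h1, h2, h3, h5.1.trans_le (min_le_left _ _), h5.2.trans_le (min_le_left _ _)⟩

/-- Subtract `ψ` from the approximants. This makes the errors `f i - φ i` again functions to which
the disjoint-support estimates apply. -/
theorem isSobolevLimit_sub (hp : 0 < p) {A : Set M} {f : Lp ℝ (ENNReal.ofReal p) m}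
    (hf : f ∈ sobolevSpaceZero n m p A) {ψ : M → ℝ} (hψ : tsupport ψ ⊆ A) :
    IsSobolevLimit n m p A (fun x ↦ f x - ψ x) := by
  intro δ hδ
  obtain ⟨φ, -, -, h3, h4, h5⟩ := exists_approx_of_mem_sobolevSpaceZero hp hf hδ
  refine ⟨fun x ↦ φ x - ψ x, ?_, by simpa using h4, by simpa using h5⟩
  refine (closure_mono (Function.support_sub φ ψ)).trans ?_
  rw [closure_union]
  exact Set.union_subset h3 hψ

theorem isSobolevLimit_of_mem (hp : 0 < p) {A : Set M} {f : Lp ℝ (ENNReal.ofReal p) m}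
    (hf : f ∈ sobolevSpaceZero n m p A) : IsSobolevLimit n m p A f := by
  simpa using isSobolevLimit_sub hp hf (ψ := fun _ ↦ 0) (by simp [tsupport, Function.support_fun_zero])

theorem lipschitzWith_sum_mul {ι : Type*} (s : Finset ι) (c : ι → ℝ) {φ : ι → M → ℝ}
    (h : ∀ i, ∃ K, LipschitzWith K (φ i)) : ∃ K, LipschitzWith K fun x ↦ ∑ i ∈ s, c i * φ i x := by
  classical
  induction s using Finset.induction_on with
  | empty => exact ⟨0, by simp⟩
  | insert a s ha ih =>
    obtain ⟨K, hK⟩ := ih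
    obtain ⟨L, hL⟩ := h a
    refine ⟨‖c a‖₊ * L + K, ?_⟩
    simp only [Finset.sum_insert ha]
    exact ((lipschitzWith_smul (c a)).comp hL).add hK

theorem exists_rpow_sum_lt (hp : 0 < p) {K ε : ℝ≥0∞} (hK : K ≠ ⊤) (hε : 0 < ε) :
    ∃ δ : ℝ≥0∞, 0 < δ ∧ (K * δ + K * δ) ^ (1 / p) < ε := by
  have hc : Continuous fun δ : ℝ≥0∞ ↦ (K * δ + K * δ) ^ (1 / p) :=
    ENNReal.continuous_rpow_const.comp
      ((ENNReal.continuous_const_mul hK).add (ENNReal.continuous_const_mul hK))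
  have h0 : ∀ᶠ δ in 𝓝 (0 : ℝ≥0∞), (K * δ + K * δ) ^ (1 / p) < ε :=
    hc.continuousAt.eventually_lt continuousAt_const (by simpa [hp] using hε)
  obtain ⟨δ, h1, h2⟩ := ((h0.filter_mono nhdsWithin_le_nhds).and
    (self_mem_nhdsWithin : Set.Ioi (0 : ℝ≥0∞) ∈ 𝓝[>] 0)).exists
  exact ⟨δ, h2, h1⟩

/-- Finitely many functions in `W_0^{1,p}` of disjoint open subsets of `U`, with Rayleigh quotients
below `l`, span an odd sphere in `W_0^{1,p}(U)` on which the energy is at most `l`. -/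
theorem exists_isOddSphereMap (hm : DominatesChartVolume (n := n) m) (hp : 0 < p) {d : ℕ}
    {A : Fin d → Set M} {U : Set M} (hA : ∀ i, IsOpen (A i))
    (hd : Pairwise fun i j ↦ Disjoint (A i) (A j)) (hU : ∀ i, A i ⊆ U)
    {f : Fin d → Lp ℝ (ENNReal.ofReal p) m} (hf : ∀ i, f i ∈ sobolevSpaceZero n m p (A i))
    (hf0 : ∀ i, f i ≠ 0) {l : ℝ≥0∞} (hl : l ≠ ⊤)
    (hfl : ∀ i, energy n m p (f i) / normPow m p (f i) < l) :
    ∃ h : Metric.sphere (0 : EuclideanSpace ℝ (Fin d)) 1 → Lp ℝ (ENNReal.ofReal p) m,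
      IsOddSphereMap n m p (sobolevSpaceZero n m p U) d h ∧ ∀ s, energy n m p (h s) ≤ l := by
  have hAm : ∀ i, MeasurableSet (A i) := fun i ↦ (hA i).measurableSet
  have hlim : ∀ i, IsSobolevLimit n m p (A i) (f i) := fun i ↦ isSobolevLimit_of_mem hp (hf i)
  have hmeas : ∀ i, AEStronglyMeasurable (f i) m := fun i ↦ Lp.aestronglyMeasurable (f i)
  set N : Fin d → ℝ := fun i ↦ (normPow m p (f i)).toReal with hN
  have hNf : ∀ i, ENNReal.ofReal (N i) = normPow m p (f i) := fun i ↦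
    ENNReal.ofReal_toReal (normPow_lt_top hp _).ne
  have hNpos : ∀ i, 0 < N i := fun i ↦
    ENNReal.toReal_pos (normPow_ne_zero hp (hf0 i)) (normPow_lt_top hp _).ne
  have hen : ∀ i, energy n m p (f i) < l * normPow m p (f i) := fun i ↦
    (ENNReal.div_lt_iff (Or.inl (normPow_ne_zero hp (hf0 i)))
      (Or.inl (normPow_lt_top hp _).ne)).1 (hfl i)
  set c : Metric.sphere (0 : EuclideanSpace ℝ (Fin d)) 1 → Fin d → ℝ :=
    fun s i ↦ signedPow (2 / p) ((s : EuclideanSpace ℝ (Fin d)) i) * N i ^ (-(1 / p)) with hc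
  have hcc : ∀ i, Continuous fun s ↦ c s i := fun i ↦
    ((continuous_signedPow (by positivity)).comp
      ((EuclideanSpace.proj (𝕜 := ℝ) i).continuous.comp continuous_subtype_val)).mul
      continuous_const
  have hcp : ∀ s, ∑ i, ‖c s i‖ₑ ^ p * normPow m p (f i) = 1 := by
    intro s
    have h1 : ∑ i, ((s : EuclideanSpace ℝ (Fin d)) i) ^ 2 = 1 := by
      have := EuclideanSpace.real_norm_sq_eq (s : EuclideanSpace ℝ (Fin d))
      rw [← this, norm_eq_of_mem_sphere s, one_pow]
    calc ∑ i, ‖c s i‖ₑ ^ p * normPow m p (f i)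
        = ∑ i, ENNReal.ofReal (((s : EuclideanSpace ℝ (Fin d)) i) ^ 2) :=
          Finset.sum_congr rfl fun i _ ↦ by
            rw [← hNf i]
            exact enorm_signedPow_mul_rpow hp (hNpos i) _
      _ = 1 := by
          rw [← ENNReal.ofReal_sum_of_nonneg fun i _ ↦ sq_nonneg _, h1, ENNReal.ofReal_one]
  have hct : ∀ x : ℝ, ‖x‖ₑ ^ p ≠ ⊤ := fun x ↦ ENNReal.rpow_ne_top_of_nonneg hp.le enorm_ne_top
  set h : Metric.sphere (0 : EuclideanSpace ℝ (Fin d)) 1 → Lp ℝ (ENNReal.ofReal p) m :=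
    fun s ↦ ∑ i, c s i • f i with hh
  have hcoe : ∀ s, h s =ᵐ[m] fun x ↦ ∑ i, c s i * f i x := fun s ↦ coeFn_sum_smul _ _ _
  have hnorm : ∀ s, normPow m p (h s) = 1 := fun s ↦ by
    rw [normPow_congr_ae (hcoe s), normPow_sum hp hAm hd hmeas hlim, hcp]
  have hle : ∀ s, energy n m p (h s) ≤ l := fun s ↦ by
    rw [energy_congr_ae hm (hcoe s)]
    refine (energy_sum_le hm hp hAm hd hlim hen (c s)).trans (le_of_eq ?_)
    simp only [mul_left_comm _ l]
    rw [← Finset.mul_sum, hcp, mul_one]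
  refine ⟨h, ⟨fun s ↦ ⟨?_, fun ε hε ↦ ?_⟩, hnorm, fun s ↦ ?_, fun s ↦ ?_⟩, hle⟩
  · refine ENNReal.rpow_lt_top_of_nonneg (one_div_pos.2 hp).le ?_
    rw [hnorm]
    exact ENNReal.add_ne_top.2 ⟨ENNReal.one_ne_top, ((hle s).trans_lt hl.lt_top).ne⟩
  -- Approximate `h s` by the same combination of approximants of the `f i`. One term `K * δ` bounds
  -- the norm of the error, the other its energy.
  · obtain ⟨δ, hδ, hδε⟩ := exists_rpow_sum_lt hp (K := ∑ i, ‖c s i‖ₑ ^ p)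
      (ENNReal.sum_ne_top.2 fun i _ ↦ hct _) hε
    choose φ hφ1 hφ2 hφ3 hφ4 hφ5 using fun i ↦ exists_approx_of_mem_sobolevSpaceZero hp (hf i) hδ
    have hsupp : Function.support (fun x ↦ ∑ i, c s i * φ i x) ⊆ ⋃ i, tsupport (φ i) := by
      intro x hx
      obtain ⟨i, -, hi⟩ := Finset.exists_ne_zero_of_sum_ne_zero hx
      exact Set.mem_iUnion.2 ⟨i, subset_tsupport _ (right_ne_zero_of_mul hi)⟩
    have hcomp : IsCompact (⋃ i, tsupport (φ i)) := isCompact_iUnion hφ2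
    refine ⟨fun x ↦ ∑ i, c s i * φ i x, lipschitzWith_sum_mul _ _ hφ1,
      HasCompactSupport.of_support_subset_isCompact hcomp hsupp,
      (closure_minimal hsupp hcomp.isClosed).trans
        (Set.iUnion_subset fun i ↦ (hφ3 i).trans (hU i)), ?_⟩
    have hae : (fun x ↦ h s x - ∑ i, c s i * φ i x) =ᵐ[m]
        fun x ↦ ∑ i, c s i * (f i x - φ i x) := by
      filter_upwards [hcoe s] with x hx
      rw [hx, ← Finset.sum_sub_distrib]
      simp only [mul_sub]
    have hlim' : ∀ i, IsSobolevLimit n m p (A i) (fun x ↦ f i x - φ i x) := fun i ↦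
      isSobolevLimit_sub hp (hf i) (hφ3 i)
    have hmeas' : ∀ i, AEStronglyMeasurable (fun x ↦ f i x - φ i x) m := fun i ↦
      (hmeas i).sub (hφ1 i).choose_spec.continuous.aestronglyMeasurable
    rw [sobolevNorm, normPow_congr_ae hae, energy_congr_ae hm hae]
    refine lt_of_le_of_lt (ENNReal.rpow_le_rpow (add_le_add ?_ ?_) (one_div_pos.2 hp).le) hδε
    · rw [normPow_sum hp hAm hd hmeas' hlim', Finset.sum_mul]
      exact Finset.sum_le_sum fun i _ ↦ by gcongr; exact (hφ4 i).le
    · rw [Finset.sum_mul]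
      exact energy_sum_le hm hp hAm hd hlim' hφ5 (c s)
  · simp only [hh, hc, ← Finset.sum_neg_distrib, ← neg_smul, ← neg_mul]
    refine Finset.sum_congr rfl fun i _ ↦ ?_
    rw [← signedPow_neg]
    rfl
  · have hae : ∀ t, (fun x ↦ h t x - h s x) =ᵐ[m] fun x ↦ ∑ i, (c t i - c s i) * f i x := by
      intro t
      filter_upwards [hcoe t, hcoe s] with x h1 h2
      rw [h1, h2, ← Finset.sum_sub_distrib]
      simp only [sub_mul]
    -- The difference `h t - h s` is again a combination of the `f i`, so its Sobolev norm is
    -- bounded by an explicit continuous function of `t` vanishing at `s`.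
    set B : Metric.sphere (0 : EuclideanSpace ℝ (Fin d)) 1 → ℝ≥0∞ := fun t ↦
      (∑ i, ‖c t i - c s i‖ₑ ^ p * normPow m p (f i) +
        ∑ i, ‖c t i - c s i‖ₑ ^ p * (l * normPow m p (f i))) ^ (1 / p) with hB
    have hBc : Continuous B := by
      have h1 : ∀ i, Continuous fun t ↦ ‖c t i - c s i‖ₑ ^ p := fun i ↦
        ENNReal.continuous_rpow_const.comp ((hcc i).sub continuous_const).enorm
      refine ENNReal.continuous_rpow_const.comp (Continuous.add ?_ ?_)
      · exact continuous_finsetSum _ fun i _ ↦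
          (ENNReal.continuous_mul_const (normPow_lt_top hp _).ne).comp (h1 i)
      · exact continuous_finsetSum _ fun i _ ↦
          (ENNReal.continuous_mul_const
            (ENNReal.mul_ne_top hl (normPow_lt_top hp _).ne)).comp (h1 i)
    have hB0 : B s = 0 := by simp [hB, hp]
    refine tendsto_of_tendsto_of_tendsto_of_le_of_le tendsto_const_nhds
      (hB0 ▸ hBc.tendsto s) (fun _ ↦ zero_le) fun t ↦ ?_
    rw [sobolevNorm, normPow_congr_ae (hae t), energy_congr_ae hm (hae t)]
    refine ENNReal.rpow_le_rpow (add_le_add ?_ ?_) (one_div_pos.2 hp).le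
    · rw [normPow_sum hp hAm hd hmeas hlim]
    · exact energy_sum_le hm hp hAm hd hlim hen _

theorem drabekRobinsonValue_le (hm : DominatesChartVolume (n := n) m) (hp : 0 < p) {d : ℕ}
    {A : Fin d → Set M} {U : Set M} {W : Set (Lp ℝ (ENNReal.ofReal p) m)}
    (hW : sobolevSpaceZero n m p U ⊆ W) (hA : ∀ i, IsOpen (A i))
    (hd : Pairwise fun i j ↦ Disjoint (A i) (A j)) (hU : ∀ i, A i ⊆ U) :
    drabekRobinsonValue n m p W d ≤ ⨆ i, firstDirichletEigenvalue n m p (A i) := by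
  refine le_of_forall_gt_imp_ge_of_dense fun l hl ↦ ?_
  rcases eq_or_ne l ⊤ with rfl | hlt
  · exact le_top
  have hf : ∀ i, ∃ f : Lp ℝ (ENNReal.ofReal p) m, f ∈ sobolevSpaceZero n m p (A i) ∧ f ≠ 0 ∧
      energy n m p f / normPow m p f < l := fun i ↦ by
    have := (le_iSup (fun i ↦ firstDirichletEigenvalue n m p (A i)) i).trans_lt hl
    simp only [firstDirichletEigenvalue, iInf_lt_iff, exists_prop] at this
    exact this
  choose f hf1 hf2 hf3 using hf
  obtain ⟨h, hh, hle⟩ := exists_isOddSphereMap hm hp hA hd hU hf1 hf2 hlt hf3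
  exact (iInf₂_le h ⟨fun s ↦ hW (hh.mem s), hh.normPow_eq_one, hh.odd, hh.continuous⟩).trans
    (iSup_le hle)

/-! ### The two volume measures -/

theorem dominatesChartVolume_riemannianVolume :
    DominatesChartVolume (n := n) (riemannianVolume n M) := fun x₀ ↦
  ⟨1, ENNReal.one_ne_top, by simpa using map_chartVolume_le x₀⟩

theorem dominatesChartVolume_normalizedVolume (h0 : riemannianVolume n M Set.univ ≠ 0)
    (h : riemannianVolume n M Set.univ ≠ ⊤) :
    DominatesChartVolume (n := n) (normalizedVolume n M) := fun x₀ ↦ by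
  refine ⟨riemannianVolume n M Set.univ, h, ?_⟩
  rw [normalizedVolume, smul_smul, ENNReal.mul_inv_cancel h0 h, one_smul]
  exact map_chartVolume_le x₀

theorem normalizedVolume_eq_zero
    (h : riemannianVolume n M Set.univ = 0 ∨ riemannianVolume n M Set.univ = ⊤) :
    normalizedVolume n M = 0 := by
  rcases h with h | h
  · rw [normalizedVolume, Measure.measure_univ_eq_zero.1 h, smul_zero]
  · rw [normalizedVolume, h, ENNReal.inv_top, zero_smul]

theorem firstDirichletEigenvalue_of_measure_eq_zero (hm : m = 0) (A : Set M) :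
    firstDirichletEigenvalue n m p A = ⊤ := by
  subst hm
  simp only [firstDirichletEigenvalue, iInf_eq_top]
  intro f _ hf
  exact absurd (Lp.ext (by simp [Filter.EventuallyEq])) hf

end Sphere

end PLaplace

end

theorem mainTheorem5
    {n : ℕ} {M : Type*} [MetricSpace M] [ChartedSpace (EuclideanSpace ℝ (Fin n)) M]
    [IsManifold (𝓡 n) ∞ M] [RiemannianBundle (fun x : M ↦ TangentSpace (𝓡 n) x)]
    [IsContMDiffRiemannianBundle (𝓡 n) ∞ (EuclideanSpace ℝ (Fin n))
      (fun x : M ↦ TangentSpace (𝓡 n) x)]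
    [IsRiemannianManifold (𝓡 n) M] [MeasurableSpace M] [BorelSpace M] [CompactSpace M]
    {d : ℕ} {N : Type*} [MetricSpace N] [ChartedSpace (EuclideanSpace ℝ (Fin d)) N]
    [IsManifold (𝓡 d) ∞ N] [RiemannianBundle (fun x : N ↦ TangentSpace (𝓡 d) x)]
    [IsContMDiffRiemannianBundle (𝓡 d) ∞ (EuclideanSpace ℝ (Fin d))
      (fun x : N ↦ TangentSpace (𝓡 d) x)]
    [IsRiemannianManifold (𝓡 d) N] [MeasurableSpace N] [BorelSpace N] [CompleteSpace N]
    (U : Set N) (hU : IsOpen U) (hUb : Bornology.IsBounded U)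
    (k : ℕ) (hk : 1 ≤ k) (p : ℝ) (hp : 1 < p) :
    PLaplace.drabekRobinsonEigenvalue n (PLaplace.normalizedVolume n M) p k ≤
        PLaplace.fakeEigenvalue n (PLaplace.normalizedVolume n M) p k ∧
      PLaplace.drabekRobinsonDirichletEigenvalue d (PLaplace.riemannianVolume d N) p U k ≤
        PLaplace.fakeDirichletEigenvalue d (PLaplace.riemannianVolume d N) p U k := by
  have hp0 : 0 < p := by linarith
  constructor
  · refine le_iInf₂ fun A hA ↦ le_iInf₂ fun _ hd ↦ ?_
    -- If the total volume is zero or infinite, the normalized measure is zero. Then `L^p` has no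
    -- nonzero element, each first eigenvalue is an infimum over the empty set, and the right side
    -- is infinite.
    by_cases h : PLaplace.riemannianVolume n M Set.univ = 0 ∨
        PLaplace.riemannianVolume n M Set.univ = ⊤
    · simp [PLaplace.firstDirichletEigenvalue_of_measure_eq_zero
        (PLaplace.normalizedVolume_eq_zero h)]
    · push Not at h
      exact PLaplace.drabekRobinsonValue_le
        (PLaplace.dominatesChartVolume_normalizedVolume h.1 h.2) hp0 (U := Set.univ)
        (fun f hf ↦ hf.1) hA hd fun i ↦ Set.subset_univ _
  · refine le_iInf₂ fun A hA ↦ le_iInf₂ fun _ hd ↦ le_iInf fun hAU ↦ ?_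
    exact PLaplace.drabekRobinsonValue_le PLaplace.dominatesChartVolume_riemannianVolume hp0
      subset_rfl hA hd fun i ↦ (hAU i).1
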